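/- **Setting.** A finite non-empty set $V$ of $m=|V|$ users is connected by a simple undirected graph $G$; $\mathcal N(v)$ is $v$ together with its neighbours. All users face the same $K$ arms. $(f(\cdot;\vartheta))_{\vartheta\in\Theta}$ is a family of discrete probability distributions on $\mathbb R$ with finite means $\mu(\vartheta)$, and arm $i$ has reward distribution $f(\cdot;\theta_i)$, $\boldsymbol\theta=(\theta_1,\dots,\theta_K)\in\Theta^K$. In each round every user $v$ plays an arm $a^v(t)$ and receives a fresh independent sample from that arm's distribution; its (possibly randomised) policy chooses $a^v(t)$ from the actions and rewards of the users in $\mathcal N(v)$ in rounds $1,\dots,t-1$, and knows neither $\boldsymbol\theta$ nor the horizon. Let $\mu^*=\max_i\mu(\theta_i)$, $\Delta_i=\mu^*-\mu(\theta_i)$ (arm $i$ is sub-optimal if $\Delta_i>0$), let $\theta^*$ be the parameter of any arm with $\mu(\theta^*)=\mu^*$, let $T_i^v(n)$ be the number of times $v$ plays arm $i$ in rounds $1,\dots,n$, and let $R^G(n)=\sum_{v\in V}\sum_{t=1}^n(\mu^*-\mu(\theta_{a^v(t)}))$. Write $kl(\beta\|\lambda)$ for the Kullback–Leibler divergence of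 $f(\cdot;\beta)$ with respect to $f(\cdot;\lambda)$. **Assumption [A1].** (i) $0<kl(\beta\|\lambda)<\infty$ whenever $\mu(\lambda)>\mu(\beta)$. (ii) For all $\varepsilon>0$ and all $\beta,\lambda$ with $\mu(\lambda)>\mu(\beta)$ there is $\eta>0$ such that $|kl(\beta\|\lambda)-kl(\beta\|\lambda')|<\varepsilon$ whenever $\mu(\lambda)\le\mu(\lambda')\le\mu(\lambda)+\eta$. (iii) For all $\lambda\in\Theta$ and $\eta>0$ there is $\lambda'\in\Theta$ with $\mu(\lambda)<\mu(\lambda')<\mu(\lambda)+\eta$. **NAIC policies.** A policy of user $v$ is *non-altruistic* if for every parameter vector in $\Theta^K$ there are $a_1,a_2$, not depending on $n$, such that for every $n$, every sub-optimal arm $i$ and all policies of the other users, the expected number of rounds $t\le n$ in which $v$ plays arm $i$ after at least $a_1\ln n$ samples of arm $i$ have been obtained by $\mathcal N(v)$ in rounds before $t$ is at most $a_2$. It is *individually consistent* if for every parameter vector in $\Theta^K$, every sub-optimal arm $i$, all policies of the neighbours of $v$, every trajectory $\omega_{\bar v}$ of possible actions and rewards of the users outside $\mathcal N(v)$, and every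 $a>0$, $\mathbb E[T_i^v(n)\mid\omega_{\bar v}]=o(n^a)$ as $n\to\infty$; here the law given $\omega_{\bar v}$ is the one in which the users outside $\mathcal N(v)$ act and are rewarded as $\omega_{\bar v}$ says, while the users in $\mathcal N(v)$ follow their policies and receive fresh samples. The policy is *NAIC* if it has both properties. **Theorem.** Suppose [A1] holds and each user follows an NAIC policy. Let $\boldsymbol\theta\in\Theta^K$ and $\delta\in(0,1)$. Then $$\liminf_{n\to\infty}\frac{\mathbb E_{\boldsymbol\theta}[R^G(n)]}{\ln n}\ \ge\ c_G\sum_{i:\,\Delta_i>0}\frac{1-\delta}{1+\delta}\cdot\frac{\Delta_i}{kl(\theta_i\|\theta^*)},$$ where $c_G=1$ if $G$ is fully connected (the complete graph), $c_G=m/3$ if $G$ is circular (a cycle on $m\ge3$ nodes), $c_G=1$ if $G$ is a star (a centre joined to all other nodes, and no other edges), and $c_G=m$ if $G$ is fully disconnected (no edges). -/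

import Mathlib

open MeasureTheory Filter Asymptotics
open scoped ENNReal Topology

/-! Multi-agent stochastic bandits on a network: users are the vertices of a finite simple graph `G`,
arms are `Fin K`, and rewards have discrete distributions (`PMF ℝ`). Rounds are numbered
`0, 1, 2, …`, so that a path of length `n` consists of the first `n` rounds. -/

namespace NetBandit

section Product

/-- The total mass of a finite product of families of masses is the product of the total masses. -/
theorem tsum_prod_eq_prod_tsum {V : Type*} [Fintype V] {α : Type*} (p : V → α → ℝ≥0∞) :
    ∑' r : V → α, ∏ v, p v (r v) = ∏ v, ∑' a, p v a := by
  suffices h : ∀ (W : Type _) [Fintype W] (q : W → α → ℝ≥0∞),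
      ∑' r : W → α, ∏ v, q v (r v) = ∏ v, ∑' a, q v a from h V p
  intro W _
  refine Fintype.induction_empty_option
    (P := fun W _ => ∀ q : W → α → ℝ≥0∞,
      ∑' r : W → α, ∏ v, q v (r v) = ∏ v, ∑' a, q v a) ?_ ?_ ?_ W
  · intro A B _ e ih q
    let _ : Fintype A := Fintype.ofEquiv B e.symm
    have h1 := ih (fun a => q (e a))
    rw [← Equiv.prod_comp e (fun b => ∑' a, q b a), ← h1,
      ← Equiv.tsum_eq (Equiv.arrowCongr e (Equiv.refl α))]
    refine tsum_congr fun r => ?_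
    rw [← Equiv.prod_comp e]
    simp [Equiv.arrowCongr]
  · intro q
    simp
  · intro A _ ih q
    rw [← Equiv.tsum_eq (Equiv.piOptionEquivProd (β := fun _ : Option A => α)).symm,
      ENNReal.tsum_prod', Fintype.prod_option, ← ih, ← ENNReal.tsum_mul_right]
    refine tsum_congr fun a => ?_
    rw [← ENNReal.tsum_mul_left]
    refine tsum_congr fun r => ?_
    rw [Fintype.prod_option]
    rfl

/-- The joint law of independent draws, one from `p v` for every `v`. -/
noncomputable def indepLaw {V : Type*} [Fintype V] {α : Type*} (p : V → PMF α) : PMF (V → α) :=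
  ⟨fun r => ∏ v, p v (r v), by
    have h : ∑' r : V → α, ∏ v, p v (r v) = 1 := by
      rw [tsum_prod_eq_prod_tsum]
      simp [PMF.tsum_coe]
    exact h ▸ ENNReal.summable.hasSum⟩

end Product

/-- The expectation of a real function under a discrete law (it is only used for functions that are
bounded, so that the series converges absolutely). -/
noncomputable def expect {α : Type*} (p : PMF α) (g : α → ℝ) : ℝ := ∑' a, (p a).toReal * g a

theorem summable_expect {α : Type*} (p : PMF α) (g : α → ℝ) (C : ℝ) (hg : ∀ a, |g a| ≤ C) :
    Summable fun a => (p a).toReal * g a := by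
  have hp : Summable fun a => (p a).toReal := ENNReal.summable_toReal p.tsum_coe_ne_top
  refine Summable.of_norm_bounded (hp.mul_right C) fun a => ?_
  rw [Real.norm_eq_abs, abs_mul, abs_of_nonneg ENNReal.toReal_nonneg]
  exact mul_le_mul_of_nonneg_left (hg a) ENNReal.toReal_nonneg

section Arms

variable {Θ : Type*} {K : ℕ}

/-- The mean reward `μ(ϑ)`. -/
noncomputable def mean (f : Θ → PMF ℝ) (ϑ : Θ) : ℝ := ∫ x, x ∂(f ϑ).toMeasure

/-- The Kullback-Leibler divergence `kl(β ‖ lam)` of the reward distributions. -/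
noncomputable def kl (f : Θ → PMF ℝ) (β lam : Θ) : ℝ≥0∞ :=
  InformationTheory.klDiv (f β).toMeasure (f lam).toMeasure

/-- The standing assumption on the parametrised family of reward distributions. -/
structure AssumptionA1 (f : Θ → PMF ℝ) : Prop where
  kl_pos_finite : ∀ β lam, mean f β < mean f lam → 0 < kl f β lam ∧ kl f β lam < ∞
  kl_continuous : ∀ ε > 0, ∀ β lam, mean f β < mean f lam → ∃ δ > 0, ∀ lam',
    mean f lam ≤ mean f lam' → mean f lam' ≤ mean f lam + δ →
      |(kl f β lam).toReal - (kl f β lam').toReal| < ε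
  mean_dense : ∀ lam, ∀ δ > 0, ∃ lam', mean f lam < mean f lam' ∧ mean f lam' < mean f lam + δ

/-- The largest mean reward `μ* = max_i μ(θ_i)`. -/
noncomputable def bestMean (f : Θ → PMF ℝ) (θ : Fin K → Θ) : ℝ := ⨆ i, mean f (θ i)

/-- The gap `Δ_i = μ* - μ(θ_i)`. -/
noncomputable def gap (f : Θ → PMF ℝ) (θ : Fin K → Θ) (i : Fin K) : ℝ :=
  bestMean f θ - mean f (θ i)

end Arms

section Network

variable {V : Type*} [Fintype V] {K : ℕ} {Θ : Type*}

/-- `𝒩(v)`: the user `v` together with its one-hop neighbours. -/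
def closedNbhd (G : SimpleGraph V) (v : V) : Set V := {u | u = v ∨ G.Adj v u}

/-- What happened in the first `n` rounds: the arm played and the reward obtained by every user. -/
abbrev Path (V : Type*) (K n : ℕ) : Type _ := Fin n → V → Fin K × ℝ

/-- A (possibly randomised) policy of the user `v`: in each round it chooses an arm from the actions
and rewards of the users in `𝒩(v)` in all earlier rounds. A deterministic policy is the case where
all these laws are point masses. -/
abbrev UserPolicy (G : SimpleGraph V) (K : ℕ) (v : V) : Type _ :=
  ∀ t : ℕ, (Fin t → closedNbhd G v → Fin K × ℝ) → PMF (Fin K)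

/-- A policy of the network: one policy for every user. The policies know neither the parameters
nor the time horizon. -/
abbrev NetPolicy (G : SimpleGraph V) (K : ℕ) : Type _ := ∀ v : V, UserPolicy G K v

/-- The law of the pair (arm, reward) of user `v` in the next round, given the past `h`: the arm is
chosen by the policy from what `v` has observed, the reward is a fresh sample of that arm. -/
noncomputable def userStep (G : SimpleGraph V) (f : Θ → PMF ℝ) (θ : Fin K → Θ) (Φ : NetPolicy G K)
    (t : ℕ) (h : Path V K t) (v : V) : PMF (Fin K × ℝ) :=
  (Φ v t fun s u => h s u).bind fun a => (f (θ a)).map fun x => (a, x)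

/-- The law of the first `n` rounds when, given the past, the users' pairs (arm, reward) in the next
round are independent with the laws `step`. -/
noncomputable def runLaw (step : ∀ t : ℕ, Path V K t → V → PMF (Fin K × ℝ)) :
    ∀ n : ℕ, PMF (Path V K n)
  | 0 => PMF.pure fun t => t.elim0
  | n + 1 => (runLaw step n).bind fun h =>
      (indepLaw (step n h)).map fun r => Fin.snoc (α := fun _ => V → Fin K × ℝ) h r

/-- The law of the first `n` rounds under the parameters `θ` when the users follow `Φ`. -/
noncomputable def pathLaw (G : SimpleGraph V) (f : Θ → PMF ℝ) (θ : Fin K → Θ) (Φ : NetPolicy G K)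
    (n : ℕ) : PMF (Path V K n) :=
  runLaw (userStep G f θ Φ) n

open Classical in
/-- The law of the first `n` rounds given the trajectory `w` of the users outside `𝒩(v)`: these
users do and get what `w` says, and the users in `𝒩(v)` follow `Φ` and get fresh samples. Its mass
at a path that agrees with `w` outside `𝒩(v)` is the product over all rounds and all `u ∈ 𝒩(v)` of
the probability of the action of `u` given its observed past and the probability of its reward. -/
noncomputable def pathLawGiven (G : SimpleGraph V) (f : Θ → PMF ℝ) (θ : Fin K → Θ)
    (Φ : NetPolicy G K) (v : V) (w : ℕ → V → Fin K × ℝ) (n : ℕ) : PMF (Path V K n) :=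
  runLaw (fun t h u => if u ∈ closedNbhd G v then userStep G f θ Φ t h u else PMF.pure (w t u)) n

open Classical in
/-- `T_i^v(n)`: how often user `v` played arm `i`. -/
noncomputable def playCount {n : ℕ} (ω : Path V K n) (v : V) (i : Fin K) : ℕ :=
  (Finset.univ.filter fun t : Fin n => (ω t v).1 = i).card

open Classical in
/-- The number of samples of arm `i` that user `v` has obtained (from itself and its neighbours)
before round `t`. -/
noncomputable def samplesBefore (G : SimpleGraph V) {n : ℕ} (ω : Path V K n) (v : V) (i : Fin K)
    (t : Fin n) : ℕ :=
  (Finset.univ.filter fun p : Fin n × V =>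
    p.1 < t ∧ p.2 ∈ closedNbhd G v ∧ (ω p.1 p.2).1 = i).card

open Classical in
/-- How often user `v` played arm `i` after having obtained at least `c` samples of it. -/
noncomputable def latePlays (G : SimpleGraph V) {n : ℕ} (ω : Path V K n) (v : V) (i : Fin K)
    (c : ℝ) : ℕ :=
  (Finset.univ.filter fun t : Fin n =>
    (ω t v).1 = i ∧ c ≤ (samplesBefore G ω v i t : ℝ)).card

/-- The regret of the network along a path. -/
noncomputable def regret (f : Θ → PMF ℝ) (θ : Fin K → Θ) {n : ℕ} (ω : Path V K n) : ℝ :=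
  ∑ v, ∑ t, (bestMean f θ - mean f (θ (ω t v).1))

/-- `E_θ[R^G(n)]`. -/
noncomputable def expectedRegret (G : SimpleGraph V) (f : Θ → PMF ℝ) (θ : Fin K → Θ)
    (Φ : NetPolicy G K) (n : ℕ) : ℝ :=
  expect (pathLaw G f θ Φ n) (regret f θ)

/-- Individually consistent: `E[T_i^v(n) | w] = o(n^a)` for all `a > 0`, for every parameter vector,
every sub-optimal arm, all policies of the neighbours, and every trajectory `w` of possible actions
and rewards of the users outside `𝒩(v)`. (The law used here does not depend on `Φ u` for `u` outside
`𝒩(v)`.) -/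
def IndividuallyConsistent (G : SimpleGraph V) (f : Θ → PMF ℝ) (v : V) (π : UserPolicy G K v) :
    Prop :=
  ∀ (θ : Fin K → Θ) (i : Fin K), 0 < gap f θ i →
    ∀ Φ : NetPolicy G K, Φ v = π →
      ∀ w : ℕ → V → Fin K × ℝ, (∀ t, ∀ u ∉ closedNbhd G v, f (θ (w t u).1) (w t u).2 ≠ 0) →
        ∀ a : ℝ, 0 < a →
          (fun n : ℕ => expect (pathLawGiven G f θ Φ v w n) fun ω => (playCount ω v i : ℝ))
            =o[atTop] fun n : ℕ => (n : ℝ) ^ a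

/-- Non-altruistic: there are `a₁, a₂` (which may depend on the parameters, not on the horizon) such
that for all `n` and all sub-optimal arms `i`, `v` plays `i` in expectation at most `a₂` times after
having obtained `a₁ ln n` samples of it, whatever policies the other users follow. -/
def NonAltruistic (G : SimpleGraph V) (f : Θ → PMF ℝ) (v : V) (π : UserPolicy G K v) : Prop :=
  ∀ θ : Fin K → Θ, ∃ a₁ a₂ : ℝ, ∀ (n : ℕ) (i : Fin K), 0 < gap f θ i →
    ∀ Φ : NetPolicy G K, Φ v = π →
      expect (pathLaw G f θ Φ n) (fun ω => (latePlays G ω v i (a₁ * Real.log n) : ℝ)) ≤ a₂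

/-- Non-altruistic and individually consistent. -/
def NAIC (G : SimpleGraph V) (f : Θ → PMF ℝ) (v : V) (π : UserPolicy G K v) : Prop :=
  NonAltruistic G f v π ∧ IndividuallyConsistent G f v π

/-- A circular network: a cycle through all users. -/
def IsCircular (G : SimpleGraph V) : Prop :=
  3 ≤ Fintype.card V ∧ Nonempty (G ≃g SimpleGraph.cycleGraph (Fintype.card V))

/-- A star network: one centre joined to all other users, and no other links. -/
def IsStar (G : SimpleGraph V) : Prop := ∃ c, G = SimpleGraph.starGraph c

/-- The sum `∑_{i : Δ_i > 0} ((1-δ)/(1+δ)) Δ_i / kl(θ_i ‖ ϑ)`. -/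
noncomputable def regretConstant (f : Θ → PMF ℝ) (θ : Fin K → Θ) (ϑ : Θ) (δ : ℝ) : ℝ :=
  ∑ i with 0 < gap f θ i, (1 - δ) / (1 + δ) * (gap f θ i / (kl f (θ i) ϑ).toReal)

/-- `liminf_n E_θ[R^G(n)] / ln n ≥ c`, with the lower limit taken in the extended reals. -/
def LogRegretAtLeast (G : SimpleGraph V) (f : Θ → PMF ℝ) (θ : Fin K → Θ) (Φ : NetPolicy G K)
    (c : ℝ) : Prop :=
  (c : EReal) ≤
    liminf (fun n : ℕ => ((expectedRegret G f θ Φ n / Real.log n : ℝ) : EReal)) atTop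

end Network

end NetBandit

/-! The core is a logarithmic lower bound for the samples of a sub-optimal arm `i` obtained in one
closed neighbourhood `S = 𝒩(v)` (`NonAltruistic.eventually_le_sampleCount`). Move the parameter of
arm `i` to some `lam` slightly better than the best arm, but only for the users in `S`. The relative
entropy of the true law with respect to this hybrid law is at most `kl(θ_i ‖ lam)` per sample of `i`
in `S` (`entropyBound_hybrid`). Under the true law `v` plays `i` only `O(ln n)` times. Under the
hybrid law it plays all the other arms only `O(ln n)` times: the users outside `S` can be thought of
as living in the modified world too, while reading rewards of arm `i` from a random tape drawn from
`f(θ_i)` (`tapeLaw_bind_pathLaw`). For each fixed tape this is just another choice of policies for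
the others, and non-altruism is uniform in these. Two laws that differ this much have relative
entropy at least about `(1 - δ) ln n` (`le_kl_mul_sampleCount`, `eventually_log_le`). Entropy is
handled through its Donsker–Varadhan dual with an outcome-dependent cost, so that the chain rule
adds up a random number of divergences without densities on path space. Finally the bounds for
several neighbourhoods are summed and divided by the multiplicity with which they overlap
(`logRegretAtLeast_of_cover`). -/

namespace NetBandit

/-! ### Expectations of bounded functions under discrete laws -/

section Expect

variable {α β : Type*}

/-- A bounded real function. -/
def IsBdd (g : α → ℝ) : Prop := ∃ C, ∀ a, |g a| ≤ C

theorem IsBdd.const (c : ℝ) : IsBdd fun _ : α => c := ⟨|c|, fun _ => le_rfl⟩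

theorem IsBdd.add {g h : α → ℝ} (hg : IsBdd g) (hh : IsBdd h) : IsBdd fun a => g a + h a := by
  obtain ⟨C, hC⟩ := hg
  obtain ⟨D, hD⟩ := hh
  exact ⟨C + D, fun a => (abs_add_le _ _).trans (add_le_add (hC a) (hD a))⟩

theorem IsBdd.mul {g h : α → ℝ} (hg : IsBdd g) (hh : IsBdd h) : IsBdd fun a => g a * h a := by
  obtain ⟨C, hC⟩ := hg
  obtain ⟨D, hD⟩ := hh
  refine ⟨C * D, fun a => ?_⟩
  rw [abs_mul]
  exact mul_le_mul (hC a) (hD a) (abs_nonneg _) ((abs_nonneg _).trans (hC a))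

theorem IsBdd.const_mul {g : α → ℝ} (c : ℝ) (hg : IsBdd g) : IsBdd fun a => c * g a :=
  (IsBdd.const c).mul hg

theorem IsBdd.neg {g : α → ℝ} (hg : IsBdd g) : IsBdd fun a => -g a := by
  simpa using hg.const_mul (-1)

theorem IsBdd.sub {g h : α → ℝ} (hg : IsBdd g) (hh : IsBdd h) : IsBdd fun a => g a - h a := by
  simpa [sub_eq_add_neg] using hg.add hh.neg

theorem IsBdd.sum {ι : Type*} {s : Finset ι} {g : ι → α → ℝ} (hg : ∀ i ∈ s, IsBdd (g i)) :
    IsBdd fun a => ∑ i ∈ s, g i a := by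
  classical
  induction s using Finset.induction_on with
  | empty => simpa using IsBdd.const (α := α) 0
  | insert i s hi ih =>
    simp only [Finset.sum_insert hi]
    exact (hg i (Finset.mem_insert_self i s)).add
      (ih fun j hj => hg j (Finset.mem_insert_of_mem hj))

theorem IsBdd.comp {g : β → ℝ} (hg : IsBdd g) (φ : α → β) : IsBdd fun a => g (φ a) :=
  hg.imp fun _ hC a => hC (φ a)

theorem IsBdd.exp {g : α → ℝ} (hg : IsBdd g) : IsBdd fun a => Real.exp (g a) := by
  obtain ⟨C, hC⟩ := hg
  refine ⟨Real.exp C, fun a => ?_⟩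
  rw [abs_of_pos (Real.exp_pos _)]
  exact Real.exp_le_exp.2 ((le_abs_self _).trans (hC a))

theorem IsBdd.of_finite [Finite α] (g : α → ℝ) : IsBdd g := by
  obtain ⟨C, hC⟩ := (Set.finite_range fun a => |g a|).bddAbove
  exact ⟨C, fun a => hC ⟨a, rfl⟩⟩

theorem IsBdd.summable {g : α → ℝ} (hg : IsBdd g) (p : PMF α) :
    Summable fun a => (p a).toReal * g a :=
  let ⟨C, hC⟩ := hg
  summable_expect p g C hC

theorem expect_const (p : PMF α) (c : ℝ) : expect p (fun _ => c) = c := by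
  rw [expect, tsum_mul_right, ← ENNReal.tsum_toReal_eq fun a => p.apply_ne_top a, p.tsum_coe]
  simp

theorem expect_add (p : PMF α) {g h : α → ℝ} (hg : IsBdd g) (hh : IsBdd h) :
    expect p (fun a => g a + h a) = expect p g + expect p h := by
  simp only [expect, mul_add]
  exact (hg.summable p).tsum_add (hh.summable p)

theorem expect_const_mul (p : PMF α) (c : ℝ) (g : α → ℝ) :
    expect p (fun a => c * g a) = c * expect p g := by
  simp only [expect, ← tsum_mul_left]
  exact tsum_congr fun a => by ring

theorem expect_neg (p : PMF α) (g : α → ℝ) : expect p (fun a => -g a) = -expect p g := by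
  simpa using expect_const_mul p (-1) g

theorem expect_sub (p : PMF α) {g h : α → ℝ} (hg : IsBdd g) (hh : IsBdd h) :
    expect p (fun a => g a - h a) = expect p g - expect p h := by
  simp only [sub_eq_add_neg]
  rw [expect_add p hg hh.neg, expect_neg]

theorem expect_mono (p : PMF α) {g h : α → ℝ} (hg : IsBdd g) (hh : IsBdd h)
    (hgh : ∀ a, g a ≤ h a) : expect p g ≤ expect p h :=
  (hg.summable p).tsum_le_tsum
    (fun a => mul_le_mul_of_nonneg_left (hgh a) ENNReal.toReal_nonneg) (hh.summable p)

theorem expect_sum (p : PMF α) {ι : Type*} {s : Finset ι} {g : ι → α → ℝ}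
    (hg : ∀ i ∈ s, IsBdd (g i)) :
    expect p (fun a => ∑ i ∈ s, g i a) = ∑ i ∈ s, expect p (g i) := by
  simp only [expect, Finset.mul_sum]
  exact Summable.tsum_finsetSum fun i hi => (hg i hi).summable p

theorem IsBdd.expect {κ : α → PMF β} {g : β → ℝ} (hg : IsBdd g) :
    IsBdd fun a => expect (κ a) g := by
  obtain ⟨C, hC⟩ := hg
  have hg : IsBdd g := ⟨C, hC⟩
  refine ⟨C, fun a => abs_le.2 ⟨?_, ?_⟩⟩
  · rw [← expect_const (κ a) (-C)]
    exact expect_mono _ (.const _) hg fun b => (abs_le.1 (hC b)).1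
  · rw [← expect_const (κ a) C]
    exact expect_mono _ hg (.const _) fun b => (abs_le.1 (hC b)).2

theorem expect_eq_toReal_tsum (p : PMF α) {g : α → ℝ} (hg : ∀ a, 0 ≤ g a) :
    expect p g = (∑' a, p a * ENNReal.ofReal (g a)).toReal := by
  rw [ENNReal.tsum_toReal_eq fun a => ENNReal.mul_ne_top (p.apply_ne_top a) ENNReal.ofReal_ne_top]
  exact tsum_congr fun a => by rw [ENNReal.toReal_mul, ENNReal.toReal_ofReal (hg a)]

theorem ofReal_expect (p : PMF α) {g : α → ℝ} (hb : IsBdd g) (hg : ∀ a, 0 ≤ g a) :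
    ENNReal.ofReal (expect p g) = ∑' a, p a * ENNReal.ofReal (g a) := by
  rw [expect, ENNReal.ofReal_tsum_of_nonneg
    (fun a => mul_nonneg ENNReal.toReal_nonneg (hg a)) (hb.summable p)]
  exact tsum_congr fun a => by
    rw [ENNReal.ofReal_mul ENNReal.toReal_nonneg, ENNReal.ofReal_toReal (p.apply_ne_top a)]

theorem expect_nonneg (p : PMF α) {g : α → ℝ} (hg : ∀ a, 0 ≤ g a) : 0 ≤ expect p g :=
  tsum_nonneg fun a => mul_nonneg ENNReal.toReal_nonneg (hg a)

/-- For non-negative functions this is Tonelli in `ℝ≥0∞`; a bounded function is reduced to that case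
by adding its bound. -/
theorem expect_bind (p : PMF α) (κ : α → PMF β) {g : β → ℝ} (hg : IsBdd g) :
    expect (p.bind κ) g = expect p fun a => expect (κ a) g := by
  have key : ∀ g : β → ℝ, IsBdd g → (∀ b, 0 ≤ g b) →
      expect (p.bind κ) g = expect p fun a => expect (κ a) g := by
    intro g hb h0
    rw [expect_eq_toReal_tsum _ h0, expect_eq_toReal_tsum _ fun a => expect_nonneg _ h0]
    congr 1
    simp only [PMF.bind_apply, ofReal_expect _ hb h0, ← ENNReal.tsum_mul_right,
      ← ENNReal.tsum_mul_left]
    rw [ENNReal.tsum_comm]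
    exact tsum_congr fun a => tsum_congr fun b => by ring
  obtain ⟨C, hC⟩ := hg
  have hg : IsBdd g := ⟨C, hC⟩
  have h := key (fun b => g b + C) (hg.add (.const C)) fun b => by linarith [(abs_le.1 (hC b)).1]
  simp only [expect_add _ hg (IsBdd.const C), expect_const] at h
  rw [expect_add _ hg.expect (.const C), expect_const] at h
  linarith

theorem expect_pure (a : α) (g : α → ℝ) : expect (PMF.pure a) g = g a := by
  rw [expect, tsum_eq_single a]
  · simp
  · intro b hb
    simp [PMF.pure_apply, hb]

theorem expect_map (p : PMF α) (φ : α → β) {g : β → ℝ} (hg : IsBdd g) :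
    expect (p.map φ) g = expect p fun a => g (φ a) := by
  rw [PMF.map, expect_bind _ _ hg]
  simp [expect_pure]

end Expect

/-! ### A Donsker–Varadhan type inequality with a cost function -/

section EntropyBound

variable {α β : Type*}

/-- The entropy inequality `E_p g ≤ E_p c + ln E_q e^g` for all bounded functions `g`: the relative
entropy of `p` with respect to `q` is at most the expected cost `E_p c`. -/
def EntropyBound (p q : PMF α) (c : α → ℝ) : Prop :=
  ∀ g : α → ℝ, IsBdd g → expect p g ≤ expect p c + Real.log (expect q fun a => Real.exp (g a))

/-- Jensen's inequality, from the tangent to the exponential at `expect p g`. -/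
theorem exp_expect_le (p : PMF α) {g : α → ℝ} (hg : IsBdd g) :
    Real.exp (expect p g) ≤ expect p fun a => Real.exp (g a) := by
  have h := expect_mono p (g := fun a => Real.exp (expect p g) * (g a - expect p g + 1))
    (((hg.sub (.const _)).add (.const 1)).const_mul _) hg.exp fun a => by
      rw [← sub_add_cancel (g a) (expect p g), Real.exp_add, mul_comm (Real.exp (_ - _)),
        sub_add_cancel]
      exact mul_le_mul_of_nonneg_left (Real.add_one_le_exp _) (Real.exp_pos _).le
  rw [expect_const_mul, expect_add _ (hg.sub (.const _)) (.const 1), expect_sub _ hg (.const _),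
    expect_const, expect_const] at h
  simpa using h

theorem expect_exp_pos (p : PMF α) {g : α → ℝ} (hg : IsBdd g) :
    0 < expect p fun a => Real.exp (g a) :=
  (Real.exp_pos _).trans_le (exp_expect_le p hg)

theorem EntropyBound.refl (p : PMF α) : EntropyBound p p fun _ => 0 := by
  intro g hg
  rw [expect_const, zero_add, Real.le_log_iff_exp_le (expect_exp_pos p hg)]
  exact exp_expect_le p hg

/-- The chain rule. -/
theorem EntropyBound.bind {p q : PMF α} {κ η : α → PMF β} {c : α → ℝ} {d : β → ℝ}
    (hc : IsBdd c) (hd : IsBdd d) (hpq : EntropyBound p q c)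
    (hκ : ∀ a, EntropyBound (κ a) (η a) fun b => d b - c a) :
    EntropyBound (p.bind κ) (q.bind η) d := by
  intro g hg
  obtain ⟨C, hC⟩ := hg
  have hg : IsBdd g := ⟨C, hC⟩
  have hl : IsBdd fun a => Real.log (expect (η a) fun b => Real.exp (g b)) := by
    refine ⟨C, fun a => abs_le.2 ⟨?_, ?_⟩⟩
    · rw [Real.le_log_iff_exp_le (expect_exp_pos _ hg), ← expect_const (η a) (Real.exp (-C))]
      exact expect_mono _ (.const _) hg.exp fun b => Real.exp_le_exp.2 (abs_le.1 (hC b)).1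
    · rw [Real.log_le_iff_le_exp (expect_exp_pos _ hg), ← expect_const (η a) (Real.exp C)]
      exact expect_mono _ hg.exp (.const _) fun b => Real.exp_le_exp.2 (abs_le.1 (hC b)).2
  -- The first stage is tested on the log-Laplace transform of the second stage; its exponential
  -- averages under `q` to the exponential moment of `q.bind η`.
  have h1 := hpq _ hl
  simp only [Real.exp_log (expect_exp_pos _ hg)] at h1
  rw [expect_bind _ _ hg, expect_bind _ _ hd, expect_bind _ _ hg.exp]
  have h2 := expect_mono p (hg.expect (κ := κ)) ((hd.expect.sub hc).add hl) fun a => by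
    simpa only [expect_sub _ hd (IsBdd.const (c a)), expect_const] using hκ a g hg
  rw [expect_add _ (hd.expect.sub hc) hl, expect_sub _ hd.expect hc] at h2
  linarith

theorem EntropyBound.map {p q : PMF α} {φ : α → β} {d : β → ℝ} (hd : IsBdd d)
    (h : EntropyBound p q fun a => d (φ a)) : EntropyBound (p.map φ) (q.map φ) d := by
  intro g hg
  rw [expect_map _ _ hg, expect_map _ _ hd, expect_map _ _ hg.exp]
  exact h _ (hg.comp φ)

theorem expect_eq_integral (p : PMF ℝ) {g g' : ℝ → ℝ} (hg : IsBdd g') (hm : Measurable g')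
    (h : ∀ x ∈ p.support, g' x = g x) : expect p g = ∫ x, g' x ∂p.toMeasure := by
  obtain ⟨C, hC⟩ := hg
  rw [PMF.integral_eq_tsum _ _ (Integrable.of_bound hm.aestronglyMeasurable C
    (Eventually.of_forall hC))]
  refine tsum_congr fun x => ?_
  by_cases hx : x ∈ p.support
  · rw [h x hx, smul_eq_mul]
  · rw [PMF.mem_support_iff, not_not] at hx
    simp [hx]

theorem measurable_indicator_of_countable {S : Set ℝ} (hS : S.Countable) (g : ℝ → ℝ) :
    Measurable (S.indicator g) := by
  refine measurable_of_restrict_of_restrict_compl hS.measurableSet ?_ ?_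
  · have := hS.to_subtype
    exact measurable_of_countable _
  · have : Sᶜ.domRestrict (S.indicator g) = fun _ => 0 := by
      ext x
      exact Set.indicator_of_notMem x.2 g
    rw [this]
    exact measurable_const

/-- Tilting `q` by `g` changes the divergence by `-E_p g + ln E_q e^g`, and the divergence from the
tilted measure is non-negative. An arbitrary `g` need not be measurable, so it is cut off outside
the countable union of the two supports. -/
theorem EntropyBound.of_klDiv {p q : PMF ℝ}
    (h : InformationTheory.klDiv p.toMeasure q.toMeasure ≠ ∞) :
    EntropyBound p q fun _ => (InformationTheory.klDiv p.toMeasure q.toMeasure).toReal := by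
  intro g hg
  set S : Set ℝ := p.support ∪ q.support
  have hS : S.Countable := p.support_countable.union q.support_countable
  set g' := S.indicator g with hg'
  have hm : Measurable g' := measurable_indicator_of_countable hS g
  have hb : IsBdd g' := by
    obtain ⟨C, hC⟩ := hg
    refine ⟨C, fun x => ?_⟩
    by_cases hx : x ∈ S
    · rw [hg', Set.indicator_of_mem hx]
      exact hC x
    · rw [hg', Set.indicator_of_notMem hx, abs_zero]
      exact (abs_nonneg _).trans (hC x)
  have hint : ∀ (r : PMF ℝ) {u : ℝ → ℝ}, IsBdd u → Measurable u → Integrable u r.toMeasure :=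
    fun r u ⟨C, hC⟩ hu => Integrable.of_bound hu.aestronglyMeasurable C (Eventually.of_forall hC)
  rw [expect_const, expect_eq_integral p hb hm fun x hx =>
      Set.indicator_of_mem (Set.mem_union_left _ hx) g,
    expect_eq_integral q (g' := fun x => Real.exp (g' x)) hb.exp hm.exp fun x hx => by
      rw [hg', Set.indicator_of_mem (Set.mem_union_right _ hx)]]
  obtain ⟨hac, hllr⟩ := InformationTheory.klDiv_ne_top_iff.1 h
  have hexp := hint q hb.exp hm.exp
  have : IsProbabilityMeasure (q.toMeasure.tilted g') := isProbabilityMeasure_tilted hexp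
  have h1 := integral_llr_tilted_right hac (hint p hb hm) hexp hllr
  have hac' : p.toMeasure ≪ q.toMeasure.tilted g' := hac.trans (absolutelyContinuous_tilted hexp)
  rw [← InformationTheory.toReal_klDiv_of_measure_eq hac (by simp),
    ← InformationTheory.toReal_klDiv_of_measure_eq hac' (by simp)] at h1
  have h2 : 0 ≤ (InformationTheory.klDiv p.toMeasure (q.toMeasure.tilted g')).toReal :=
    ENNReal.toReal_nonneg
  linarith

end EntropyBound

/-! ### Independent draws -/

section IndepLaw

theorem indepLaw_apply {V : Type*} [Fintype V] {α : Type*} (p : V → PMF α) (r : V → α) :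
    indepLaw p r = ∏ v, p v (r v) := rfl

theorem indepLaw_bind {V : Type*} [Fintype V] {α β : Type*} (p : V → PMF α)
    (κ : V → α → PMF β) :
    (indepLaw fun v => (p v).bind (κ v)) =
      (indepLaw p).bind fun x => indepLaw fun v => κ v (x v) := by
  ext r
  simp only [indepLaw_apply, PMF.bind_apply, ← Finset.prod_mul_distrib]
  rw [← tsum_prod_eq_prod_tsum fun v a => p v a * κ v a (r v)]

theorem indepLaw_pure {V : Type*} [Fintype V] {α : Type*} (x : V → α) :
    (indepLaw fun v => PMF.pure (x v)) = PMF.pure x := by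
  classical
  ext r
  simp only [indepLaw_apply, PMF.pure_apply]
  by_cases h : r = x
  · simp [h]
  · obtain ⟨v, hv⟩ := Function.ne_iff.1 h
    rw [if_neg h]
    exact Finset.prod_eq_zero (Finset.mem_univ v) (if_neg hv)

theorem indepLaw_equiv {V W : Type*} [Fintype V] [Fintype W] {α : Type*} (e : V ≃ W)
    (p : W → PMF α) :
    indepLaw p = (indepLaw fun v => p (e v)).map fun r w => r (e.symm w) := by
  classical
  ext r
  rw [PMF.map_apply, tsum_eq_single fun v => r (e v)]
  · rw [if_pos (by ext; simp), indepLaw_apply, indepLaw_apply,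
      Equiv.prod_comp e fun w => p w (r w)]
  · intro s hs
    refine if_neg fun h => hs ?_
    subst h
    simp

theorem indepLaw_option {V : Type*} [Fintype V] {α : Type*} (p : Option V → PMF α) :
    indepLaw p = (p none).bind fun a =>
      (indepLaw fun v => p (some v)).map fun r o => o.elim a r := by
  classical
  ext r
  rw [PMF.bind_apply, tsum_eq_single (r none)]
  · rw [PMF.map_apply, tsum_eq_single fun v => r (some v)]
    · rw [if_pos, indepLaw_apply, indepLaw_apply, Fintype.prod_option]
      ext o
      cases o <;> rfl
    · intro s hs
      exact if_neg fun h => hs (funext fun v => (congrFun h (some v)).symm)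
  · intro a ha
    rw [PMF.map_apply, ENNReal.tsum_eq_zero.2, mul_zero]
    intro s
    refine if_neg fun h => ha ?_
    rw [h]
    rfl

/-- Tensorization: the costs of independent draws add up. -/
theorem EntropyBound.indepLaw {V : Type*} [Fintype V] {α : Type*} {p q : V → PMF α}
    {c : V → α → ℝ} (hc : ∀ v, IsBdd (c v)) (h : ∀ v, EntropyBound (p v) (q v) (c v)) :
    EntropyBound (indepLaw p) (indepLaw q) fun r => ∑ v, c v (r v) := by
  suffices H : ∀ (W : Type _) [Fintype W] (p q : W → PMF α) (c : W → α → ℝ),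
      (∀ w, IsBdd (c w)) → (∀ w, EntropyBound (p w) (q w) (c w)) →
      EntropyBound (NetBandit.indepLaw p) (NetBandit.indepLaw q) fun r => ∑ w, c w (r w) from
    H V p q c hc h
  intro W _
  -- Induction on the index type up to bijection; one additional draw is one application of the
  -- chain rule.
  refine Fintype.induction_empty_option
    (P := fun W _ => ∀ (p q : W → PMF α) (c : W → α → ℝ),
      (∀ w, IsBdd (c w)) → (∀ w, EntropyBound (p w) (q w) (c w)) →
      EntropyBound (NetBandit.indepLaw p) (NetBandit.indepLaw q) fun r => ∑ w, c w (r w))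
    ?_ ?_ ?_ W
  · intro A B _ e ih p q c hc h
    let _ : Fintype A := Fintype.ofEquiv B e.symm
    rw [indepLaw_equiv e p, indepLaw_equiv e q]
    refine EntropyBound.map (.sum fun w _ => (hc w).comp _) ?_
    have := ih (fun a => p (e a)) (fun a => q (e a)) (fun a => c (e a)) (fun a => hc _)
      fun a => h _
    simpa only [← Equiv.sum_comp e fun w => _, Equiv.symm_apply_apply] using this
  · intro p q c _ _
    have hpq : p = q := Subsingleton.elim _ _
    subst hpq
    simpa using EntropyBound.refl (NetBandit.indepLaw p)
  · intro A _ ih p q c hc h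
    rw [indepLaw_option p, indepLaw_option q]
    have hsum : IsBdd fun r : Option A → α => ∑ w, c w (r w) := .sum fun w _ => (hc w).comp _
    refine EntropyBound.bind (hc none) hsum (h none) fun a => ?_
    refine EntropyBound.map (hsum.sub (.const _)) ?_
    have := ih (fun w => p (some w)) (fun w => q (some w)) (fun w => c (some w))
      (fun w => hc _) fun w => h _
    simpa [Fintype.sum_option] using this

end IndepLaw

end NetBandit

namespace NetBandit

/-! ### Replacing rewards outside a neighbourhood by a tape -/

section Tape

variable {V : Type*} {K : ℕ} {Θ : Type*}

open Classical in
/-- Replace the reward of the user `u` by `y` if `u` is outside `S` and played arm `i`. -/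
noncomputable def replaceReward (S : Set V) (i : Fin K) (y : ℝ) (u : V) (r : Fin K × ℝ) :
    Fin K × ℝ :=
  if u ∉ S ∧ r.1 = i then (i, y) else r

theorem replaceReward_fst (S : Set V) (i : Fin K) (y : ℝ) (u : V) (r : Fin K × ℝ) :
    (replaceReward S i y u r).1 = r.1 := by
  unfold replaceReward
  split_ifs with h
  · exact h.2.symm
  · rfl

theorem replaceReward_of_mem {S : Set V} (i : Fin K) (y : ℝ) {u : V} (hu : u ∈ S)
    (r : Fin K × ℝ) : replaceReward S i y u r = r :=
  if_neg fun h => h.1 hu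

/-- Replace the rewards of arm `i` outside `S` by the entries of the tape `z`. -/
noncomputable def replacePath (S : Set V) (i : Fin K) (z : ℕ → V → ℝ) {n : ℕ} (ω : Path V K n) :
    Path V K n :=
  fun t u => replaceReward S i (z t u) u (ω t u)

/-- The policies that read the tape `z` in place of the rewards of arm `i` outside `S`. -/
noncomputable def tapedPolicy (G : SimpleGraph V) (Φ : NetPolicy G K) (S : Set V) (i : Fin K)
    (z : ℕ → V → ℝ) : NetPolicy G K :=
  fun w t h => Φ w t fun s u => replaceReward S i (z s u) u (h s u)

/-- User `v` sees only its closed neighbourhood, where no reward is overwritten. Hence bounds for `Φ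
v` that are uniform in the other users' policies apply for every tape. -/
theorem tapedPolicy_self (G : SimpleGraph V) (Φ : NetPolicy G K) (v : V) (i : Fin K)
    (z : ℕ → V → ℝ) : tapedPolicy G Φ (closedNbhd G v) i z v = Φ v := by
  funext t h
  simp only [tapedPolicy, replaceReward_of_mem _ _ (Subtype.property _)]

theorem userStep_tapedPolicy (G : SimpleGraph V) (f : Θ → PMF ℝ) (θ : Fin K → Θ)
    (Φ : NetPolicy G K) (S : Set V) (i : Fin K) (z : ℕ → V → ℝ) (t : ℕ) (h : Path V K t) :
    userStep G f θ (tapedPolicy G Φ S i z) t h = userStep G f θ Φ t (replacePath S i z h) := rfl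

open Classical in
/-- The step in which the users in `S` get their rewards from `θ'` and the others from `θ`. -/
noncomputable def hybridStep (G : SimpleGraph V) (f : Θ → PMF ℝ) (θ θ' : Fin K → Θ)
    (Φ : NetPolicy G K) (S : Set V) (t : ℕ) (h : Path V K t) (u : V) : PMF (Fin K × ℝ) :=
  if u ∈ S then userStep G f θ' Φ t h u else userStep G f θ Φ t h u

/-- Outside `S`, overwriting a `lam`-sample of arm `i` by an independent draw from `f (θ i)` leaves
exactly such a draw; the other arms have the same law under both parameter vectors. -/
theorem bind_userStep_replaceReward (G : SimpleGraph V) (f : Θ → PMF ℝ) (θ : Fin K → Θ)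
    (Φ : NetPolicy G K) (S : Set V) (i : Fin K) (lam : Θ) (t : ℕ) (h : Path V K t) (u : V) :
    ((f (θ i)).bind fun y => (userStep G f (Function.update θ i lam) Φ t h u).bind fun r =>
      PMF.pure (replaceReward S i y u r)) =
      hybridStep G f θ (Function.update θ i lam) Φ S t h u := by
  by_cases hu : u ∈ S
  · simp [hybridStep, hu, replaceReward, PMF.bind_pure, PMF.bind_const]
  · rw [PMF.bind_comm]
    simp only [hybridStep, hu, if_false, userStep, PMF.bind_bind]
    congr 1
    funext a
    rw [PMF.bind_map]
    by_cases ha : a = i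
    · subst ha
      simp only [Function.comp_def, replaceReward, hu, not_false_eq_true, and_self, if_true]
      rw [PMF.bind_const]
      rfl
    · simp only [Function.comp_def, replaceReward, ha, and_false, if_false, PMF.bind_const,
        Function.update_of_ne ha]
      rfl

theorem replacePath_update {S : Set V} {i : Fin K} {z : ℕ → V → ℝ} {n : ℕ} (y : V → ℝ)
    {t : ℕ} (ht : t ≤ n) (ω : Path V K t) :
    replacePath S i (Function.update z n y) ω = replacePath S i z ω := by
  funext s u
  rw [replacePath, replacePath, Function.update_of_ne (s.2.trans_le ht).ne]

theorem replacePath_snoc (S : Set V) (i : Fin K) (z : ℕ → V → ℝ) {n : ℕ} (y : V → ℝ)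
    (ω : Path V K n) (r : V → Fin K × ℝ) :
    replacePath S i (Function.update z n y)
        (Fin.snoc (α := fun _ => V → Fin K × ℝ) ω r : Path V K (n + 1)) =
      Fin.snoc (α := fun _ => V → Fin K × ℝ) (replacePath S i z ω)
        fun u => replaceReward S i (y u) u (r u) := by
  funext s
  induction s using Fin.lastCases with
  | last =>
    funext u
    simp [replacePath]
  | cast s =>
    have h := congrFun (replacePath_update (S := S) (i := i) (z := z) y le_rfl ω) s
    funext u
    have h := congrFun h u
    simpa [replacePath] using h

/-! ### Laws of whole runs: entropy cost and the hybrid law as a mixture over tapes -/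

variable [Fintype V]

theorem runLaw_congr {s s' : ∀ t : ℕ, Path V K t → V → PMF (Fin K × ℝ)} {n : ℕ}
    (h : ∀ t < n, s t = s' t) : runLaw s n = runLaw s' n := by
  induction n with
  | zero => rfl
  | succ n ih =>
    rw [runLaw, runLaw, ih fun t ht => h t (ht.trans n.lt_succ_self), h n n.lt_succ_self]

/-- Chain rule over the rounds, tensorization over the users. Since the cost `c` may depend on the
outcome, the total can count plays of an arm. -/
theorem EntropyBound.runLaw {s s' : ∀ t : ℕ, Path V K t → V → PMF (Fin K × ℝ)}
    {c : V → Fin K × ℝ → ℝ} (hc : ∀ v, IsBdd (c v))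
    (h : ∀ t ω v, EntropyBound (s t ω v) (s' t ω v) (c v)) (n : ℕ) :
    EntropyBound (runLaw s n) (runLaw s' n) fun ω => ∑ t, ∑ v, c v (ω t v) := by
  have hb : ∀ n, IsBdd fun ω : Path V K n => ∑ t, ∑ v, c v (ω t v) := fun n =>
    .sum fun t _ => .sum fun v _ => (hc v).comp _
  induction n with
  | zero =>
    rw [NetBandit.runLaw, NetBandit.runLaw]
    simpa using EntropyBound.refl _
  | succ n ih =>
    refine EntropyBound.bind (hb n) (hb (n + 1)) ih fun ω => ?_
    refine EntropyBound.map ((hb (n + 1)).sub (.const _)) ?_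
    simpa [Fin.sum_univ_castSucc] using EntropyBound.indepLaw hc (h n ω)

/-- The law of a tape whose first `n` rows consist of independent draws from `p`. -/
noncomputable def tapeLaw (V : Type*) [Fintype V] (p : PMF ℝ) : ℕ → PMF (ℕ → V → ℝ)
  -- Rows that are not drawn are zero; runs of length `n` never read them.
  | 0 => PMF.pure fun _ _ => 0
  | n + 1 => (tapeLaw V p n).bind fun z =>
      (indepLaw fun _ => p).map fun y => Function.update z n y

/-- The hybrid law is the average over the tapes of the laws of the taped policies. -/
theorem tapeLaw_bind_pathLaw (G : SimpleGraph V) (f : Θ → PMF ℝ) (θ : Fin K → Θ)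
    (Φ : NetPolicy G K) (S : Set V) (i : Fin K) (lam : Θ) (n : ℕ) :
    ((tapeLaw V (f (θ i)) n).bind fun z =>
      (pathLaw G f (Function.update θ i lam) (tapedPolicy G Φ S i z) n).map
        (replacePath S i z)) =
      runLaw (hybridStep G f θ (Function.update θ i lam) Φ S) n := by
  induction n with
  | zero =>
    simp only [tapeLaw, PMF.pure_bind, pathLaw, runLaw, PMF.pure_map]
    congr 1
    exact Subsingleton.elim _ _
  | succ n ih =>
    -- In round `t ≤ n` the policies read only the rows before `t`, so the new row `n` matters only
    -- for the final replacement.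
    have hcongr : ∀ (z : ℕ → V → ℝ) (y : V → ℝ) (t : ℕ), t < n + 1 →
        userStep G f (Function.update θ i lam)
            (tapedPolicy G Φ S i (Function.update z n y)) t =
          userStep G f (Function.update θ i lam) (tapedPolicy G Φ S i z) t := by
      intro z y t ht
      funext h
      rw [userStep_tapedPolicy, userStep_tapedPolicy, replacePath_update y (Nat.lt_succ_iff.1 ht)]
    rw [tapeLaw, runLaw, ← ih, PMF.bind_bind, PMF.bind_bind]
    congr 1
    funext z
    have h1 : ∀ y, pathLaw G f (Function.update θ i lam)
        (tapedPolicy G Φ S i (Function.update z n y)) (n + 1) =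
          pathLaw G f (Function.update θ i lam) (tapedPolicy G Φ S i z) (n + 1) := fun y =>
      runLaw_congr (hcongr z y)
    simp only [PMF.bind_map, Function.comp_def, h1]
    simp only [pathLaw, runLaw, PMF.map_bind, PMF.map_comp, Function.comp_def, replacePath_snoc]
    -- Row `n` is independent of the first `n` rounds and can be drawn after them, where it merges
    -- with the last step user by user.
    rw [PMF.bind_comm]
    congr 1
    funext ω
    rw [userStep_tapedPolicy]
    have h2 : hybridStep G f θ (Function.update θ i lam) Φ S n (replacePath S i z ω) = fun u =>
        (f (θ i)).bind fun y =>
          (userStep G f (Function.update θ i lam) Φ n (replacePath S i z ω) u).bind fun r =>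
            PMF.pure (replaceReward S i y u r) :=
      funext fun u => (bind_userStep_replaceReward ..).symm
    rw [h2, indepLaw_bind, PMF.map_bind]
    congr 1
    funext y
    rw [indepLaw_bind, PMF.map_bind]
    simp only [indepLaw_pure, PMF.pure_map]
    rfl

/-- A bound valid for every tape survives averaging; `hrep` holds for functions of the actions
alone, such as play counts. -/
theorem expect_hybrid_le (G : SimpleGraph V) (f : Θ → PMF ℝ) (θ : Fin K → Θ)
    (Φ : NetPolicy G K) (S : Set V) (i : Fin K) (lam : Θ) (n : ℕ) {F : Path V K n → ℝ}
    (hF : IsBdd F) (hrep : ∀ z ω, F (replacePath S i z ω) = F ω) {C : ℝ}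
    (hC : ∀ z, expect (pathLaw G f (Function.update θ i lam) (tapedPolicy G Φ S i z) n) F ≤ C) :
    expect (runLaw (hybridStep G f θ (Function.update θ i lam) Φ S) n) F ≤ C := by
  rw [← tapeLaw_bind_pathLaw, expect_bind _ _ hF,
    ← expect_const (tapeLaw V (f (θ i)) n) C]
  refine expect_mono _ hF.expect (.const C) fun z => ?_
  rw [expect_map _ _ hF]
  simpa only [hrep] using hC z

/-- Changing the law of arm `i` in `S` costs a divergence for every sample of `i` in `S`. -/
theorem entropyBound_hybrid (G : SimpleGraph V) (f : Θ → PMF ℝ) (θ : Fin K → Θ)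
    (Φ : NetPolicy G K) (S : Set V) [DecidablePred (· ∈ S)] (i : Fin K) (lam : Θ)
    (hkl : kl f (θ i) lam ≠ ∞) (n : ℕ) :
    EntropyBound (pathLaw G f θ Φ n)
      (runLaw (hybridStep G f θ (Function.update θ i lam) Φ S) n)
      fun ω => ∑ t, ∑ u, if u ∈ S ∧ (ω t u).1 = i then (kl f (θ i) lam).toReal else 0 := by
  classical
  have hb : ∀ (u : V) (a : Fin K),
      IsBdd fun _ : ℝ => if u ∈ S ∧ a = i then (kl f (θ i) lam).toReal else 0 :=
    fun u a => .const _
  have hc : ∀ u : V, IsBdd fun r : Fin K × ℝ =>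
      if u ∈ S ∧ r.1 = i then (kl f (θ i) lam).toReal else 0 :=
    fun u => (IsBdd.of_finite fun a : Fin K =>
      if u ∈ S ∧ a = i then (kl f (θ i) lam).toReal else 0).comp Prod.fst
  refine EntropyBound.runLaw
    (c := fun u r => if u ∈ S ∧ r.1 = i then (kl f (θ i) lam).toReal else 0) hc ?_ n
  intro t h u
  by_cases hu : u ∈ S
  · simp only [hybridStep, hu, if_true, true_and, userStep]
    have hd := hc u
    simp only [hu, true_and] at hd
    -- The arm is chosen with the same law on both sides, at cost 0; only the reward of arm `i`
    -- costs a divergence.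
    refine EntropyBound.bind (.const 0) hd (.refl _) fun a => ?_
    refine EntropyBound.map (hd.sub (.const 0)) ?_
    by_cases ha : a = i
    · subst ha
      simpa [kl] using EntropyBound.of_klDiv hkl
    · simpa [ha] using EntropyBound.refl _
  · simpa [hybridStep, hu] using EntropyBound.refl _

end Tape

end NetBandit

namespace NetBandit

/-! ### Sample counts -/

section Counts

variable {V : Type*} {K : ℕ} {Θ : Type*}

theorem playCount_le {n : ℕ} (ω : Path V K n) (v : V) (i : Fin K) : playCount ω v i ≤ n := by
  classical
  exact (Finset.card_filter_le _ _).trans_eq (by simp)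

theorem isBdd_playCount (n : ℕ) (v : V) (i : Fin K) :
    IsBdd fun ω : Path V K n => (playCount ω v i : ℝ) :=
  ⟨n, fun ω => by
    rw [Nat.abs_cast]
    exact Nat.cast_le.2 (playCount_le ω v i)⟩

theorem playCount_eq_sum [DecidableEq (Fin K)] {n : ℕ} (ω : Path V K n) (v : V) (i : Fin K) :
    (playCount ω v i : ℝ) = ∑ t, if (ω t v).1 = i then 1 else 0 := by
  rw [playCount, Finset.sum_boole]
  congr!

theorem sum_playCount {n : ℕ} (ω : Path V K n) (v : V) :
    ∑ i, (playCount ω v i : ℝ) = n := by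
  simp only [playCount_eq_sum]
  rw [Finset.sum_comm]
  simp

theorem playCount_replacePath (S : Set V) (i : Fin K) (z : ℕ → V → ℝ) {n : ℕ} (ω : Path V K n)
    (v : V) (j : Fin K) : playCount (replacePath S i z ω) v j = playCount ω v j := by
  simp only [playCount, replacePath, replaceReward_fst]

variable [Fintype V]

theorem isBdd_latePlays (G : SimpleGraph V) (n : ℕ) (v : V) (i : Fin K) (c : ℝ) :
    IsBdd fun ω : Path V K n => (latePlays G ω v i c : ℝ) :=
  ⟨n, fun ω => by
    classical
    rw [Nat.abs_cast]
    exact Nat.cast_le.2 ((Finset.card_filter_le _ _).trans_eq (by simp))⟩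

/-- At most `c + 1` plays take place before `c` samples have been obtained. -/
theorem playCount_le_latePlays (G : SimpleGraph V) {n : ℕ} (ω : Path V K n) (v : V) (i : Fin K)
    (c : ℝ) : (playCount ω v i : ℝ) ≤ latePlays G ω v i c + (|c| + 1) := by
  classical
  set E := Finset.univ.filter fun t : Fin n =>
    (ω t v).1 = i ∧ (samplesBefore G ω v i t : ℝ) < c with hE
  have hsplit : playCount ω v i ≤ latePlays G ω v i c + E.card := by
    unfold playCount latePlays
    refine (Finset.card_le_card ?_).trans (Finset.card_union_le _ _)
    intro t ht
    simp only [Finset.mem_filter, Finset.mem_univ, true_and, Finset.mem_union, hE] at ht ⊢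
    rcases le_or_gt c (samplesBefore G ω v i t : ℝ) with h | h
    · exact Or.inl ⟨ht, h⟩
    · exact Or.inr ⟨ht, h⟩
  have hcard : (E.card : ℝ) ≤ |c| + 1 := by
    rcases E.eq_empty_or_nonempty with h | h
    · rw [h]
      simp
      positivity
    -- At the last early play `s`, all other early plays of `v` are among the fewer than `c` samples
    -- obtained so far; `s` itself gives the `+ 1`.
    · have hs := E.max'_mem h
      set s := E.max' h with hsdef
      have hlt : (E.erase s).card ≤ samplesBefore G ω v i s := by
        unfold samplesBefore
        refine Finset.card_le_card_of_injOn (fun t => (t, v)) ?_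
          fun a _ b _ hab => (Prod.ext_iff.1 hab).1
        intro t ht
        rw [Finset.mem_coe, Finset.mem_erase] at ht
        have htE := (Finset.mem_filter.1 ht.2).2
        have hts : t < s := lt_of_le_of_ne (E.le_max' t ht.2) ht.1
        simp only [Finset.coe_filter, Finset.mem_univ, true_and, Set.mem_ofPred_eq]
        exact ⟨hts, Or.inl rfl, htE.1⟩
      rw [Finset.card_erase_of_mem hs] at hlt
      have h1 : (E.card : ℝ) ≤ samplesBefore G ω v i s + 1 := by
        exact_mod_cast (by omega : E.card ≤ samplesBefore G ω v i s + 1)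
      have h2 := (Finset.mem_filter.1 hs).2.2
      linarith [le_abs_self c]
  have : (playCount ω v i : ℝ) ≤ latePlays G ω v i c + E.card := by exact_mod_cast hsplit
  linarith

/-- A non-altruistic user plays sub-optimal arms logarithmically often, uniformly in the policies
of the other users. -/
theorem NonAltruistic.exists_playCount_le {G : SimpleGraph V} {f : Θ → PMF ℝ} {v : V}
    {π : UserPolicy G K v} (h : NonAltruistic G f v π) (θ : Fin K → Θ) :
    ∃ C : ℝ, 0 ≤ C ∧ ∀ (n : ℕ) (i : Fin K), 0 < gap f θ i → ∀ Φ : NetPolicy G K, Φ v = π →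
      expect (pathLaw G f θ Φ n) (fun ω => (playCount ω v i : ℝ)) ≤ C * (Real.log n + 1) := by
  obtain ⟨a₁, a₂, h⟩ := h θ
  refine ⟨|a₁| + |a₂| + 1, by positivity, fun n i hi Φ hΦ => ?_⟩
  have h1 := h n i hi Φ hΦ
  have h2 := expect_mono (pathLaw G f θ Φ n) (isBdd_playCount n v i)
    ((isBdd_latePlays G n v i (a₁ * Real.log n)).add (.const _))
    fun ω => playCount_le_latePlays G ω v i (a₁ * Real.log n)
  rw [expect_add _ (isBdd_latePlays G n v i _) (.const _), expect_const] at h2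
  have hl : 0 ≤ Real.log n := Real.log_natCast_nonneg n
  rw [abs_mul, abs_of_nonneg hl] at h2
  nlinarith [le_abs_self a₂, abs_nonneg a₁, mul_nonneg (abs_nonneg a₂) hl]

/-! ### Change of measure for the samples in a set of users -/

open Classical in
/-- The number of samples of arm `i` obtained by the users in `S`. -/
noncomputable def sampleCount {n : ℕ} (ω : Path V K n) (S : Set V) (i : Fin K) : ℝ :=
  ∑ u with u ∈ S, (playCount ω u i : ℝ)

theorem isBdd_sampleCount (n : ℕ) (S : Set V) (i : Fin K) :
    IsBdd fun ω : Path V K n => sampleCount ω S i :=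
  .sum fun u _ => isBdd_playCount n u i

theorem sampleCount_mul [DecidableEq (Fin K)] {n : ℕ} (ω : Path V K n) (S : Set V)
    [DecidablePred (· ∈ S)] (i : Fin K) (κ : ℝ) :
    ∑ t, ∑ u, (if u ∈ S ∧ (ω t u).1 = i then κ else 0) = κ * sampleCount ω S i := by
  rw [sampleCount, Finset.sum_comm, Finset.mul_sum, Finset.sum_filter]
  refine Finset.sum_congr rfl fun u _ => ?_
  by_cases hu : u ∈ S
  · simp only [hu, true_and, if_true, playCount_eq_sum, Finset.mul_sum, mul_ite, mul_one,
      mul_zero]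
  · simp [hu]

/-- The chord of the convex exponential lies above it. This bounds the exponential moment of a
fraction of rounds by its mean. -/
theorem exp_mul_le_one_add {s L : ℝ} (hs0 : 0 ≤ s) (hs1 : s ≤ 1) :
    Real.exp (L * s) ≤ 1 + s * Real.exp L := by
  have h := convexOn_exp.2 (Set.mem_univ 0) (Set.mem_univ L) (sub_nonneg.2 hs1) hs0 (by ring)
  simp only [smul_eq_mul, mul_zero, zero_add, Real.exp_zero, mul_one] at h
  rw [mul_comm L s]
  linarith

/-- The change-of-measure inequality for the samples of arm `i` obtained by the users in `S`. -/
theorem le_kl_mul_sampleCount (G : SimpleGraph V) (f : Θ → PMF ℝ) (θ : Fin K → Θ)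
    (Φ : NetPolicy G K) (S : Set V) (i : Fin K) (lam : Θ) (hkl : kl f (θ i) lam ≠ ∞) (v : V)
    {n : ℕ} (hn : 0 < n) (L : ℝ) {A B : ℝ}
    (hA : expect (pathLaw G f θ Φ n) (fun ω => (playCount ω v i : ℝ)) ≤ A) (hL : 0 ≤ L)
    (hB : expect (runLaw (hybridStep G f θ (Function.update θ i lam) Φ S) n)
      (fun ω => (n : ℝ) - playCount ω v i) ≤ B) :
    L * (1 - A / n) ≤ (kl f (θ i) lam).toReal *
      expect (pathLaw G f θ Φ n) (fun ω => sampleCount ω S i) +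
        Real.log (1 + B / n * Real.exp L) := by
  classical
  have hn' : (0 : ℝ) < n := Nat.cast_pos.2 hn
  have hT := isBdd_playCount (V := V) (K := K) n v i
  have hs : IsBdd fun ω : Path V K n => (n : ℝ)⁻¹ * ((n : ℝ) - playCount ω v i) :=
    ((IsBdd.const (n : ℝ)).sub hT).const_mul _
  -- The test function is `L` times the fraction of rounds in which `v` does not play `i`: its mean
  -- is at least `L * (1 - A / n)` under the true law, while that fraction has mean at most `B / n`
  -- under the hybrid law.
  have h := entropyBound_hybrid G f θ Φ S i lam hkl n _ (hs.const_mul L)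
  simp only [sampleCount_mul] at h
  rw [expect_const_mul, expect_const_mul, expect_const_mul, expect_sub _ (.const _) hT,
    expect_const] at h
  set P := pathLaw G f θ Φ n
  set H := runLaw (hybridStep G f θ (Function.update θ i lam) Φ S) n
  have h1 : L * (1 - A / n) ≤ L * ((n : ℝ)⁻¹ * ((n : ℝ) -
      expect P fun ω => (playCount ω v i : ℝ))) := by
    refine mul_le_mul_of_nonneg_left ?_ hL
    rw [mul_sub, inv_mul_cancel₀ hn'.ne', div_eq_inv_mul]
    have := mul_le_mul_of_nonneg_left hA (inv_pos.2 hn').le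
    linarith
  have h2 : Real.log (expect H fun ω =>
      Real.exp (L * ((n : ℝ)⁻¹ * ((n : ℝ) - playCount ω v i)))) ≤
        Real.log (1 + B / n * Real.exp L) := by
    refine Real.log_le_log (expect_exp_pos _ (hs.const_mul L)) ?_
    have h3 := expect_mono H (hs.const_mul L).exp
      ((IsBdd.const 1).add (hs.const_mul (Real.exp L))) fun ω => by
        have hle : (playCount ω v i : ℝ) ≤ n := by exact_mod_cast playCount_le ω v i
        rw [mul_comm (Real.exp L)]
        refine exp_mul_le_one_add (mul_nonneg (inv_pos.2 hn').le (by linarith)) ?_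
        rw [inv_mul_le_one₀ hn']
        linarith [(Nat.cast_nonneg (playCount ω v i) : (0 : ℝ) ≤ _)]
    rw [expect_add _ (.const 1) (hs.const_mul _), expect_const, expect_const_mul,
      expect_const_mul] at h3
    refine h3.trans (add_le_add_right ?_ 1)
    rw [mul_comm, div_eq_inv_mul]
    exact mul_le_mul_of_nonneg_right (mul_le_mul_of_nonneg_left hB (inv_pos.2 hn').le)
      (Real.exp_pos L).le
  linarith

end Counts

end NetBandit

namespace NetBandit

/-! ### The logarithmic lower bound -/

theorem tendsto_add_one_mul_exp_neg {b : ℝ} (hb : 0 < b) :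
    Tendsto (fun x : ℝ => (x + 1) * Real.exp (-(b * x))) atTop (𝓝 0) := by
  have hbx : Tendsto (fun x : ℝ => b * x) atTop atTop := tendsto_id.const_mul_atTop hb
  have h1 := ((Real.tendsto_pow_mul_exp_neg_atTop_nhds_zero 1).comp hbx).const_mul b⁻¹
  have h0 := (Real.tendsto_pow_mul_exp_neg_atTop_nhds_zero 0).comp hbx
  have h := h1.add h0
  simp only [Function.comp_def, pow_one, pow_zero, one_mul, mul_zero, add_zero] at h
  refine h.congr fun x => ?_
  field_simp

/-- The loss `δ` is split in three. With `L = (1 - δ/2) ln n` the term `e^L ln n / n` tends to 0, so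
the last logarithm is at most `ln 2`; this and the factor `1 - C (ln n + 1) / n` cost `δ/4` each. -/
theorem eventually_log_le {δ : ℝ} (hδ0 : 0 < δ) (hδ1 : δ < 1) (C D : ℝ) :
    ∀ᶠ n : ℕ in atTop, (1 - δ) * Real.log n ≤
      (1 - δ / 2) * Real.log n * (1 - C * (Real.log n + 1) / n) -
        Real.log (1 + D * (Real.log n + 1) / n * Real.exp ((1 - δ / 2) * Real.log n)) := by
  have hlog : Tendsto (fun n : ℕ => Real.log n) atTop atTop :=
    Real.tendsto_log_atTop.comp tendsto_natCast_atTop_atTop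
  have h1 := ((tendsto_add_one_mul_exp_neg one_pos).const_mul C).comp hlog
  have h2 := ((tendsto_add_one_mul_exp_neg (half_pos hδ0)).const_mul D).comp hlog
  rw [mul_zero] at h1 h2
  filter_upwards [h1.eventually_lt_const (by positivity : 0 < δ / 4),
    h2.eventually_lt_const one_pos, h2.eventually_const_lt (by norm_num : (-1 : ℝ) < 0),
    hlog.eventually_ge_atTop (4 / δ * Real.log 2), hlog.eventually_ge_atTop 0,
    eventually_gt_atTop 0] with n h1 h2 h3 h4 h5 hn
  have hn' : (0 : ℝ) < n := Nat.cast_pos.2 hn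
  simp only [Function.comp_def, one_mul] at h1 h2 h3
  have e1 : Real.exp (-Real.log n) = (n : ℝ)⁻¹ := by rw [Real.exp_neg, Real.exp_log hn']
  have e2 : D * (Real.log n + 1) / n * Real.exp ((1 - δ / 2) * Real.log n) =
      D * ((Real.log n + 1) * Real.exp (-(δ / 2 * Real.log n))) := by
    have : (1 - δ / 2) * Real.log n = Real.log n + -(δ / 2 * Real.log n) := by ring
    rw [this, Real.exp_add, Real.exp_log hn']
    field_simp
  have e3 : C * (Real.log n + 1) / n = C * ((Real.log n + 1) * Real.exp (-Real.log n)) := by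
    rw [e1, div_eq_mul_inv, mul_assoc]
  rw [e2, e3]
  have hlog2 : Real.log (1 + D * ((Real.log n + 1) * Real.exp (-(δ / 2 * Real.log n)))) ≤
      Real.log 2 := Real.log_le_log (by linarith) (by linarith)
  have h6 : Real.log 2 ≤ δ / 4 * Real.log n := by
    calc Real.log 2 = δ / 4 * (4 / δ * Real.log 2) := by field_simp
      _ ≤ _ := mul_le_mul_of_nonneg_left h4 (by positivity)
  have h7 : (1 - 3 * δ / 4) * Real.log n ≤ (1 - δ / 2) * Real.log n *
      (1 - C * ((Real.log n + 1) * Real.exp (-Real.log n))) := by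
    rw [mul_right_comm]
    refine mul_le_mul_of_nonneg_right ?_ h5
    nlinarith
  linarith

section LowerBound

variable {V : Type*} [Fintype V] {K : ℕ} {Θ : Type*}

theorem mean_le_bestMean (f : Θ → PMF ℝ) (θ : Fin K → Θ) (i : Fin K) :
    mean f (θ i) ≤ bestMean f θ :=
  le_ciSup (f := fun i => mean f (θ i)) (Set.finite_range _).bddAbove i

theorem bestMean_eq {f : Θ → PMF ℝ} {θ : Fin K → Θ} {k : Fin K}
    (hk : ∀ i, mean f (θ i) ≤ mean f (θ k)) : bestMean f θ = mean f (θ k) :=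
  have : Nonempty (Fin K) := ⟨k⟩
  le_antisymm (ciSup_le hk) (mean_le_bestMean f θ k)

theorem gap_nonneg (f : Θ → PMF ℝ) (θ : Fin K → Θ) (i : Fin K) : 0 ≤ gap f θ i :=
  sub_nonneg.2 (mean_le_bestMean f θ i)

/-- The neighbourhood of a non-altruistic user obtains logarithmically many samples of every
sub-optimal arm. -/
theorem NonAltruistic.eventually_le_sampleCount {G : SimpleGraph V} {f : Θ → PMF ℝ}
    (hA1 : AssumptionA1 f) {Φ : NetPolicy G K} {v : V} (h : NonAltruistic G f v (Φ v))
    {θ : Fin K → Θ} {k : Fin K} (hk : ∀ i, mean f (θ i) ≤ mean f (θ k))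
    {δ : ℝ} (hδ0 : 0 < δ) (hδ1 : δ < 1) {i : Fin K} (hi : 0 < gap f θ i) :
    ∀ᶠ n : ℕ in atTop, (1 - δ) / (1 + δ) * (Real.log n / (kl f (θ i) (θ k)).toReal) ≤
      expect (pathLaw G f θ Φ n) fun ω => sampleCount ω (closedNbhd G v) i := by
  classical
  have hik : mean f (θ i) < mean f (θ k) := by
    rw [gap, bestMean_eq hk] at hi
    linarith
  obtain ⟨hpos, hfin⟩ := hA1.kl_pos_finite _ _ hik
  have hκ : 0 < (kl f (θ i) (θ k)).toReal := ENNReal.toReal_pos hpos.ne' hfin.ne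
  set κ := (kl f (θ i) (θ k)).toReal
  -- Accuracy `δ * κ` is the source of the factor `1 + δ`.
  obtain ⟨η, hη, hcont⟩ := hA1.kl_continuous (δ * κ) (mul_pos hδ0 hκ) _ _ hik
  obtain ⟨lam, hlam1, hlam2⟩ := hA1.mean_dense (θ k) η hη
  obtain ⟨-, hfin'⟩ := hA1.kl_pos_finite _ _ (hik.trans hlam1)
  have hκ' : (kl f (θ i) lam).toReal ≤ (1 + δ) * κ := by
    have := (abs_lt.1 (hcont lam hlam1.le hlam2.le)).1
    linarith
  set θ' := Function.update θ i lam
  -- Under `θ'` arm `i` is the unique best arm, so non-altruism limits the plays of every other arm.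
  have hgap : ∀ j, j ≠ i → 0 < gap f θ' j := by
    intro j hj
    have h1 := mean_le_bestMean f θ' i
    have h2 : θ' i = lam := Function.update_self ..
    have h3 : θ' j = θ j := Function.update_of_ne hj ..
    rw [h2] at h1
    rw [gap, h3]
    linarith [hk j]
  obtain ⟨C, -, hC⟩ := h.exists_playCount_le θ
  obtain ⟨D, hD0, hD⟩ := h.exists_playCount_le θ'
  filter_upwards [eventually_log_le hδ0 hδ1 C (K * D), eventually_gt_atTop 0] with n hlog hn
  have hl : 0 ≤ Real.log n := Real.log_natCast_nonneg n
  have hB : expect (runLaw (hybridStep G f θ θ' Φ (closedNbhd G v)) n)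
      (fun ω => (n : ℝ) - playCount ω v i) ≤ K * D * (Real.log n + 1) := by
    have hsum : (fun ω : Path V K n => (n : ℝ) - playCount ω v i) =
        fun ω => ∑ j ∈ Finset.univ.erase i, (playCount ω v j : ℝ) := by
      funext ω
      rw [← sum_playCount ω v, Finset.sum_erase_eq_sub (Finset.mem_univ i)]
    rw [hsum, expect_sum _ fun j _ => isBdd_playCount n v j]
    have hle : ∀ j ∈ Finset.univ.erase i,
        expect (runLaw (hybridStep G f θ θ' Φ (closedNbhd G v)) n)
          (fun ω => (playCount ω v j : ℝ)) ≤ D * (Real.log n + 1) := fun j hj =>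
      expect_hybrid_le G f θ Φ _ i lam n (isBdd_playCount n v j)
        (fun z ω => by rw [playCount_replacePath])
        fun z => hD n j (hgap j (Finset.ne_of_mem_erase hj)) _ (tapedPolicy_self G Φ v i z)
    refine (Finset.sum_le_card_nsmul _ _ _ hle).trans ?_
    rw [nsmul_eq_mul, mul_assoc]
    refine mul_le_mul_of_nonneg_right ?_ (mul_nonneg hD0 (by linarith))
    exact_mod_cast (Finset.card_le_univ _).trans_eq (Fintype.card_fin K)
  have hmain := le_kl_mul_sampleCount G f θ Φ (closedNbhd G v) i lam hfin'.ne v hn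
    ((1 - δ / 2) * Real.log n) (hC n i hi Φ rfl) (mul_nonneg (by linarith) hl) hB
  have hN : 0 ≤ expect (pathLaw G f θ Φ n) fun ω => sampleCount ω (closedNbhd G v) i :=
    expect_nonneg _ fun ω => Finset.sum_nonneg fun u _ => Nat.cast_nonneg _
  have hfinal : (1 - δ) * Real.log n ≤ (1 + δ) * κ *
      expect (pathLaw G f θ Φ n) fun ω => sampleCount ω (closedNbhd G v) i := by
    linarith [mul_le_mul_of_nonneg_right hκ' hN]
  rw [div_mul_div_comm, div_le_iff₀ (mul_pos (by linarith) hκ), mul_comm (expect _ _)]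
  exact hfinal

/-! ### From neighbourhood samples to the regret of the network -/

theorem regret_eq (f : Θ → PMF ℝ) (θ : Fin K → Θ) {n : ℕ} (ω : Path V K n) :
    regret f θ ω = ∑ i, gap f θ i * ∑ u, (playCount ω u i : ℝ) := by
  simp only [Finset.mul_sum]
  rw [Finset.sum_comm, regret]
  refine Finset.sum_congr rfl fun u _ => ?_
  simp only [playCount_eq_sum, Finset.mul_sum]
  rw [Finset.sum_comm]
  refine Finset.sum_congr rfl fun t _ => ?_
  simp [gap]

open Classical in
/-- If every user lies in the neighbourhoods of at most `d` users in `T`, then the samples obtained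
in these neighbourhoods are counted at most `d` times in the regret. -/
theorem sum_gap_mul_sampleCount_le (G : SimpleGraph V) (f : Θ → PMF ℝ) (θ : Fin K → Θ)
    (T : Finset V) (d : ℕ) (hT : ∀ u, (T.filter fun v => u ∈ closedNbhd G v).card ≤ d)
    {n : ℕ} (ω : Path V K n) :
    ∑ v ∈ T, ∑ i with 0 < gap f θ i, gap f θ i * sampleCount ω (closedNbhd G v) i ≤
      d * regret f θ ω := by
  rw [regret_eq, Finset.sum_comm, Finset.mul_sum]
  have hnn : ∀ u i, (0 : ℝ) ≤ playCount ω u i := fun u i => Nat.cast_nonneg _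
  refine (Finset.sum_le_sum fun i _ => ?_).trans
    (Finset.sum_le_sum_of_subset_of_nonneg (Finset.filter_subset _ _) fun i _ _ =>
      mul_nonneg (Nat.cast_nonneg d)
        (mul_nonneg (gap_nonneg f θ i) (Finset.sum_nonneg fun u _ => hnn u i)))
  rw [← Finset.mul_sum, mul_left_comm]
  refine mul_le_mul_of_nonneg_left ?_ (gap_nonneg f θ i)
  simp only [sampleCount, Finset.sum_filter]
  rw [Finset.sum_comm, Finset.mul_sum]
  refine Finset.sum_le_sum fun u _ => ?_
  rw [← Finset.sum_filter, Finset.sum_const, nsmul_eq_mul]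
  exact mul_le_mul_of_nonneg_right (Nat.cast_le.2 (hT u)) (hnn u i)

theorem isBdd_regret (f : Θ → PMF ℝ) (θ : Fin K → Θ) (n : ℕ) :
    IsBdd fun ω : Path V K n => regret f θ ω := by
  simp only [regret_eq]
  exact .sum fun i _ => (IsBdd.sum fun u _ => isBdd_playCount n u i).const_mul _

-- Each neighbourhood of a user in `T` contributes the full single-neighbourhood constant, and
-- overlaps inflate the sum by at most `d`; this gives the factor `|T| / d`.
open Classical in
theorem logRegretAtLeast_of_cover (G : SimpleGraph V) {f : Θ → PMF ℝ} (hA1 : AssumptionA1 f)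
    {Φ : NetPolicy G K} (hΦ : ∀ v, NonAltruistic G f v (Φ v)) {θ : Fin K → Θ} {k : Fin K}
    (hk : ∀ i, mean f (θ i) ≤ mean f (θ k)) {δ : ℝ} (hδ0 : 0 < δ) (hδ1 : δ < 1)
    (T : Finset V) {d : ℕ} (hd : 0 < d)
    (hT : ∀ u, (T.filter fun v => u ∈ closedNbhd G v).card ≤ d) :
    LogRegretAtLeast G f θ Φ ((T.card : ℝ) / d * regretConstant f θ (θ k) δ) := by
  have hall : ∀ᶠ n : ℕ in atTop, ∀ v, ∀ i, 0 < gap f θ i →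
      (1 - δ) / (1 + δ) * (Real.log n / (kl f (θ i) (θ k)).toReal) ≤
        expect (pathLaw G f θ Φ n) fun ω => sampleCount ω (closedNbhd G v) i := by
    refine eventually_all.2 fun v => eventually_all.2 fun i => ?_
    by_cases hi : 0 < gap f θ i
    · exact ((hΦ v).eventually_le_sampleCount hA1 hk hδ0 hδ1 hi).mono fun n hn _ => hn
    · exact Eventually.of_forall fun n h => absurd h hi
  refine le_liminf_of_le (by isBoundedDefault) ?_
  filter_upwards [hall, eventually_gt_atTop 1] with n hn hn1
  have hlog : 0 < Real.log n := Real.log_pos (by exact_mod_cast hn1)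
  have hd' : (0 : ℝ) < d := Nat.cast_pos.2 hd
  rw [EReal.coe_le_coe_iff, le_div_iff₀ hlog, div_mul_eq_mul_div, div_mul_eq_mul_div,
    div_le_iff₀ hd', mul_comm (expectedRegret _ _ _ _ _)]
  have hS : ∀ v i, IsBdd fun ω : Path V K n =>
      gap f θ i * sampleCount ω (closedNbhd G v) i :=
    fun v i => (isBdd_sampleCount n (closedNbhd G v) i).const_mul _
  have h1 := expect_mono (pathLaw G f θ Φ n) (.sum fun v _ => .sum fun i _ => hS v i)
    ((isBdd_regret f θ n).const_mul d) fun ω => sum_gap_mul_sampleCount_le G f θ T d hT ω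
  rw [expect_const_mul, expect_sum _ fun v _ => .sum fun i _ => hS v i] at h1
  refine le_trans ?_ h1
  rw [mul_assoc, ← nsmul_eq_mul]
  refine Finset.card_nsmul_le_sum _ _ _ fun v _ => ?_
  rw [expect_sum _ fun i _ => hS v i, regretConstant, Finset.sum_mul]
  refine Finset.sum_le_sum fun i hi => ?_
  rw [expect_const_mul]
  have hg := (Finset.mem_filter.1 hi).2
  refine le_trans (le_of_eq ?_) (mul_le_mul_of_nonneg_left (hn v i hg) hg.le)
  ring

end LowerBound

/-- Every user of a circular network lies in at most three neighbourhoods. -/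
theorem IsCircular.card_filter_le {V : Type*} [Fintype V] {G : SimpleGraph V} (hG : IsCircular G)
    (u : V) [DecidablePred fun v => u ∈ closedNbhd G v] :
    (Finset.univ.filter fun v => u ∈ closedNbhd G v).card ≤ 3 := by
  classical
  obtain ⟨h3, ⟨e⟩⟩ := hG
  have hdeg : G.degree u = 2 := by
    obtain ⟨m, hm⟩ := Nat.exists_eq_add_of_le' h3
    rw [← e.degree_eq u]
    generalize e u = w
    revert w
    rw [hm]
    intro w
    convert SimpleGraph.cycleGraph_degree_three_le (v := w)
  have hsub : (Finset.univ.filter fun v => u ∈ closedNbhd G v) ⊆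
      insert u (G.neighborFinset u) := by
    intro v hv
    rcases (Finset.mem_filter.1 hv).2 with h | h
    · exact Finset.mem_insert.2 (Or.inl h.symm)
    · exact Finset.mem_insert_of_mem ((G.mem_neighborFinset u v).2 h.symm)
  refine (Finset.card_le_card hsub).trans ((Finset.card_insert_le _ _).trans ?_)
  rw [G.card_neighborFinset_eq_degree, hdeg]

end NetBandit

theorem mainTheorem9 {V : Type*} [Fintype V] [Nonempty V] (G : SimpleGraph V)
    {Θ : Type*} (f : Θ → PMF ℝ)
    (hmean : ∀ ϑ, Integrable (fun x : ℝ => x) (f ϑ).toMeasure)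
    (hA1 : NetBandit.AssumptionA1 f)
    {K : ℕ} (Φ : NetBandit.NetPolicy G K) (hΦ : ∀ v, NetBandit.NAIC G f v (Φ v))
    (θ : Fin K → Θ) (k : Fin K)
    (hk : ∀ i, NetBandit.mean f (θ i) ≤ NetBandit.mean f (θ k))
    (δ : ℝ) (hδ0 : 0 < δ) (hδ1 : δ < 1) :
    (G = ⊤ →
      NetBandit.LogRegretAtLeast G f θ Φ (NetBandit.regretConstant f θ (θ k) δ)) ∧
    (NetBandit.IsCircular G →
      NetBandit.LogRegretAtLeast G f θ Φ
        ((Fintype.card V : ℝ) / 3 * NetBandit.regretConstant f θ (θ k) δ)) ∧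
    (NetBandit.IsStar G →
      NetBandit.LogRegretAtLeast G f θ Φ (NetBandit.regretConstant f θ (θ k) δ)) ∧
    (G = ⊥ →
      NetBandit.LogRegretAtLeast G f θ Φ
        ((Fintype.card V : ℝ) * NetBandit.regretConstant f θ (θ k) δ)) := by
  classical
  have hNA : ∀ v, NetBandit.NonAltruistic G f v (Φ v) := fun v => (hΦ v).1
  -- A single neighbourhood, with `T = {c}` and `d = 1`, gives the constant 1 in any network; this
  -- settles the complete graph and the star.
  have hsingle : ∀ c : V, NetBandit.LogRegretAtLeast G f θ Φ
      (NetBandit.regretConstant f θ (θ k) δ) := fun c => by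
    simpa using NetBandit.logRegretAtLeast_of_cover G hA1 hNA hk hδ0 hδ1 {c} one_pos
      fun u => (Finset.card_filter_le _ _).trans_eq (Finset.card_singleton c)
  refine ⟨fun _ => hsingle (Classical.arbitrary V), fun hG => ?_, fun _ =>
    hsingle (Classical.arbitrary V), fun hG => ?_⟩
  · simpa using NetBandit.logRegretAtLeast_of_cover G hA1 hNA hk hδ0 hδ1 Finset.univ
      (d := 3) (by norm_num) fun u => hG.card_filter_le u
  -- Without edges the neighbourhoods are disjoint singletons, so all `m` users count with `d = 1`.
  · have := NetBandit.logRegretAtLeast_of_cover G hA1 hNA hk hδ0 hδ1 Finset.univ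
      one_pos fun u => Finset.card_le_one.2 fun a ha b hb => by
        subst hG
        simp only [NetBandit.closedNbhd, SimpleGraph.bot_adj, or_false, Finset.mem_filter,
          Set.mem_ofPred_eq] at ha hb
        rw [← ha.2, ← hb.2]
    simpa using this
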